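/- Let $X$ be a discrete torsion Abelian group containing no elements of order $2$ and such that for every prime $p$ the $p$-component of $X$ (the subgroup of all elements whose order is a power of $p$) is cyclic. Let $\alpha$ be an automorphism of $X$ and let $I$ be the identity automorphism. Let $\xi_1$ and $\xi_2$ be independent random variables with values in $X$ and distributions $\mu_1$ and $\mu_2$. Assume that the conditional distribution of the linear form $L_2=\xi_1+\alpha\xi_2$ given $L_1=\xi_1+\xi_2$ is symmetric. Then the following statements are true. (i) If $\mathrm{Ker}(I+\alpha)=\{0\}$, then there is a finite subgroup $G$ of $X$ such that both $\mu_1$ and $\mu_2$ are shifts of the Haar distribution $m_G$ (the Haar measure of $G$ of total mass $1$, regarded as a distribution on $X$). (ii) If neither of the characteristic functions $\hat\mu_j(y)=\int_X (x,y)\,d\mu_j(x)$, $j=1,2$, vanishes at any point $y$ of the character group of $X$, then there is a distribution $\lambda$ supported in $\mathrm{Ker}(I+\alpha)$ such that both $\mu_1$ and $\mu_2$ are shifts of $\lambda$. Here a distribution is a Borel probability measure on $X$, and $\mu$ is a shift of $\lambda$ if $\mu=E_x*\lambda$ for some $x\in X$, where $E_x$ is the degenerate distribution concentrated at $x$. 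-/

import Mathlib

open MeasureTheory ProbabilityTheory

namespace Heyde

/-- The conditional distribution of `L₂` given `L₁` is symmetric: there is a (regular) conditional
distribution `κ` of `L₂` given `L₁` such that for almost every value `x` of `L₁` the distribution
`κ x` is invariant under `t ↦ -t`. -/
def CondDistribSymmetric {Ω X : Type*} [MeasurableSpace Ω] [AddCommGroup X] [MeasurableSpace X]
    (L₂ L₁ : Ω → X) (P : Measure Ω) : Prop :=
  ∃ κ : Kernel X X, IsMarkovKernel κ ∧ HasCondDistrib L₂ L₁ κ P ∧
    ∀ᵐ x ∂(P.map L₁), (κ x).map (fun t => -t) = κ x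

/-- The characteristic function `y ↦ ∫ (x, y) dμ(x)` of a distribution `μ` on a discrete Abelian
group `X`. As `X` is discrete, every homomorphism from `X` to the circle group is continuous, so
the character group of `X` is `AddChar X Circle`. -/
noncomputable def charFn {X : Type*} [AddCommGroup X] [MeasurableSpace X]
    (μ : Measure X) (y : AddChar X Circle) : ℂ :=
  ∫ x, (y x : ℂ) ∂μ

/-- `μ` is a shift of `ν`: it is the image of `ν` under some translation `t ↦ x + t`
(equivalently, the convolution of `ν` with the degenerate distribution at `x`). -/
def IsShift {X : Type*} [AddCommGroup X] [MeasurableSpace X] (μ ν : Measure X) : Prop :=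
  ∃ x : X, μ = ν.map (fun t => x + t)

/-- The Haar distribution of a compact subgroup `G` of `X`: the Haar measure of `G` of total
mass `1`, regarded as a measure on `X`. -/
noncomputable def haarDistribution {X : Type*} [AddCommGroup X] [TopologicalSpace X]
    [IsTopologicalAddGroup X] [MeasurableSpace X] [BorelSpace X]
    (G : AddSubgroup X) [CompactSpace G] : Measure X :=
  (Measure.addHaarMeasure (⊤ : TopologicalSpace.PositiveCompacts G)).map (Subtype.val : G → X)

/-- The kernel of `I + α`. -/
def kerOneAdd {X : Type*} [AddCommGroup X] (α : X ≃+ X) : AddSubgroup X :=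
  (AddMonoidHom.id X + (α : X →+ X)).ker

end Heyde

/-! A finite set of points of `X` lies in a finite cyclic direct summand `C`, the kernel of
multiplication by a suitable integer, and the automorphism acts on `C` as multiplication by an
integer `a` (`exists_finite_retract`). Projecting to `C` reduces everything to a functional equation
for two characteristic functions on the finite dual of `C` (`charFnEq_comp`).

Let `f`, `g` be the moduli of these functions. Substituting `u = -a v` and `u = -v` and iterating
gives `f ((1-a)² v) = f ((1+a)(1-a) v) f (4a v) g (2a(1+a) v)`, hence `f ((1-a)² v) ≤ f (4a v)`.
Here `4a` is a unit, because there is no element of order 2. On a finite module an inequality `f (d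
v) ≤ f v` valid for all `v` is an equality (`IsCharModulus.map_smul_of_le`), so `g (2a(1+a) v) = 1`
wherever `f (4a v) ≠ 0`; the same holds with `f` and `g` exchanged.

For (i), `1 + a` is a unit, so `f` and `g` are the indicator of one set and both projected
distributions are uniform on cosets of its annihilator. As this holds for arbitrarily large `C`, all
atoms of each distribution on `X` have the same mass; the supports are therefore finite, and one `C`
containing both finishes the argument.

For (ii), `f = g = 1` on multiples of `1 + a`, so each distribution lives on a coset of `Ker (I +
α)`, where `α` is negation. After centring, `L₁ ± L₂` become the doubles of the two variables, and
symmetry identifies their laws (`exists_common_shift`). -/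

namespace Heyde

/-! ### The functional equation for moduli on a module over a finite ring -/

/-- The properties of the modulus of the characteristic function of a distribution, as a function on
the dual group, that are used below. -/
structure IsCharModulus {Y : Type*} [AddCommGroup Y] (f : Y → ℝ) : Prop where
  nonneg : ∀ y, 0 ≤ f y
  le_one : ∀ y, f y ≤ 1
  map_zero : f 0 = 1
  map_neg : ∀ y, f (-y) = f y
  map_add_of_eq_one : ∀ y z, f y = 1 → f (y + z) = f z

lemma exists_pow_isIdempotentElem {R : Type*} [Monoid R] [Finite R] (d : R) :
    ∃ k : ℕ, k ≠ 0 ∧ d ^ k * d ^ k = d ^ k := by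
  obtain ⟨i, j, hij, h⟩ := Finite.exists_ne_map_eq_of_infinite (fun n : ℕ => d ^ n)
  wlog hlt : i < j generalizing i j
  · exact this j i hij.symm h.symm (by omega)
  obtain ⟨t, rfl⟩ := Nat.exists_eq_add_of_lt hlt
  have h1 : ∀ n, i ≤ n → ∀ m : ℕ, d ^ n = d ^ (n + m * (t + 1)) := by
    intro n hn m
    obtain ⟨s, rfl⟩ := Nat.exists_eq_add_of_le hn
    induction m with
    | zero => simp
    | succ m ih =>
      rw [ih, show i + s + (m + 1) * (t + 1) = (i + t + 1) + (s + m * (t + 1)) by ring, pow_add d (i + t + 1),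
        ← h, ← pow_add, ← add_assoc]
  -- Powers of `d` have period `t + 1` from exponent `i` on; this exponent is a nonzero multiple of
  -- the period and is at least `i`.
  refine ⟨(i + 1) * (t + 1), by positivity, ?_⟩
  rw [← pow_add]
  exact (h1 ((i + 1) * (t + 1)) (by nlinarith) (i + 1)).symm

section
variable {R Y : Type*} [CommRing R] [AddCommGroup Y] [Module R Y]

lemma le_pow_smul {f : Y → ℝ} {d : R} (hd : ∀ v, f (d • v) ≤ f v) (k : ℕ) (v : Y) :
    f (d ^ k • v) ≤ f v := by
  induction k with
  | zero => simp
  | succ k ih =>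
    rw [pow_succ', mul_smul]
    exact (hd _).trans ih

/-- Let `e` be an idempotent positive power of `d`. Then `f ((1-e) v) ≥ f (e(1-e) v) = f 0 = 1`, so
`(1-e) v` is a period of `f` and `f v = f (e v) ≤ f (d v)`. -/
lemma IsCharModulus.map_smul_of_le [Finite R] {f : Y → ℝ} (hf : IsCharModulus f) {d : R}
    (hd : ∀ v, f (d • v) ≤ f v) (v : Y) : f (d • v) = f v := by
  obtain ⟨k, hk, he⟩ := exists_pow_isIdempotentElem d
  obtain ⟨k, rfl⟩ := Nat.exists_eq_succ_of_ne_zero hk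
  have h1 : f ((1 - d ^ (k + 1)) • v) = 1 := by
    refine le_antisymm (hf.le_one _) ?_
    have := le_pow_smul hd (k + 1) ((1 - d ^ (k + 1)) • v)
    rwa [smul_smul, mul_sub, mul_one, he, sub_self, zero_smul, hf.map_zero] at this
  have h2 := hf.map_add_of_eq_one _ (d ^ (k + 1) • v) h1
  rw [← add_smul, sub_add_cancel, one_smul] at h2
  refine le_antisymm (hd v) ?_
  rw [h2, pow_succ, mul_smul]
  exact le_pow_smul hd k _

/-- The functional equation for the moduli of the characteristic functions. -/
def HeydeEq (a : R) (f g : Y → ℝ) : Prop :=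
  ∀ u v : Y, f (u + v) * g (u + a • v) = f (u - v) * g (u - a • v)

section
variable {a : R} {f g : Y → ℝ}

/-- The choice `u = -a v` turns the first `g`-factor into `g 0 = 1`; evenness adjusts the signs.
`HeydeEq.right` uses `u = -v` in the same way. -/
lemma HeydeEq.left (hf : IsCharModulus f) (hg : IsCharModulus g) (h : HeydeEq a f g) (v : Y) :
    f ((1 - a) • v) = f ((1 + a) • v) * g ((2 * a) • v) := by
  have := h (-(a • v)) v
  rw [neg_add_cancel, hg.map_zero, mul_one, ← hf.map_neg (-(a • v) - v),
    ← hg.map_neg (-(a • v) - a • v)] at this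
  convert this using 2
  · module
  · congr 1; module
  · congr 1; module

lemma HeydeEq.right (hf : IsCharModulus f) (hg : IsCharModulus g) (h : HeydeEq a f g) (v : Y) :
    g ((1 - a) • v) = f ((2 : R) • v) * g ((1 + a) • v) := by
  have := h (-v) v
  rw [neg_add_cancel, hf.map_zero, one_mul, ← hf.map_neg (-v - v),
    ← hg.map_neg (-v - a • v), ← hg.map_neg] at this
  convert this using 2
  · module
  · congr 1; module
  · congr 1; module

/-- Applying `left` at `(1 - a) v` and then `right` at `2a v` produces a factor of `f` itself at the
unit multiple `4a v`, against which the left side can be compared. -/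
lemma HeydeEq.left_sq (hf : IsCharModulus f) (hg : IsCharModulus g) (h : HeydeEq a f g) (v : Y) :
    f ((1 - a) ^ 2 • v) =
      f (((1 + a) * (1 - a)) • v) * (f ((4 * a) • v) * g (((1 + a) * (2 * a)) • v)) := by
  have h1 := h.left hf hg ((1 - a) • v)
  have h2 := h.right hf hg ((2 * a) • v)
  simp only [smul_smul] at h1 h2
  rw [sq, h1, show 2 * a * (1 - a) = (1 - a) * (2 * a) by ring, h2,
    show 2 * (2 * a) = 4 * a by ring]

lemma HeydeEq.right_sq (hf : IsCharModulus f) (hg : IsCharModulus g) (h : HeydeEq a f g) (v : Y) :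
    g ((1 - a) ^ 2 • v) =
      g (((1 + a) * (1 - a)) • v) * (g ((4 * a) • v) * f (((1 + a) * 2) • v)) := by
  have h1 := h.right hf hg ((1 - a) • v)
  have h2 := h.left hf hg ((2 : R) • v)
  simp only [smul_smul] at h1 h2
  rw [sq, h1, show 2 * (1 - a) = (1 - a) * 2 by ring, h2,
    show 2 * a * 2 = 4 * a by ring]
  ring

/-- The factors `h₁`, `h₂` are at most `1`, so `f (d v) ≤ f (w v)`; by `map_smul_of_le` for `d w⁻¹`
this is an equality, which leaves no room for `h₂ v < 1` unless `f (w v) = 0`. -/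
lemma IsCharModulus.eq_one_of_sq_eq [Finite R] {f h₁ h₂ : Y → ℝ} (hf : IsCharModulus f) {d w : R}
    (h₁1 : ∀ v, h₁ v ≤ 1) (h₂0 : ∀ v, 0 ≤ h₂ v) (h₂1 : ∀ v, h₂ v ≤ 1)
    (hw : IsUnit w) (h : ∀ v, f (d • v) = h₁ v * (f (w • v) * h₂ v)) (v : Y)
    (hv : f (w • v) ≠ 0) : h₂ v = 1 := by
  obtain ⟨w, rfl⟩ := hw
  have hle : ∀ v, f (d • v) ≤ f ((w : R) • v) := by
    intro v
    rw [h v]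
    have := hf.nonneg ((w : R) • v)
    calc h₁ v * (f ((w : R) • v) * h₂ v) ≤ 1 * (f ((w : R) • v) * 1) := by
          gcongr
          · exact mul_nonneg this (h₂0 v)
          · exact h₁1 v
          · exact h₂1 v
      _ = _ := by ring
  have heq := hf.map_smul_of_le (d := d * ↑w⁻¹) (fun v => by
    have := hle ((↑w⁻¹ : R) • v)
    rwa [smul_smul, smul_smul, Units.mul_inv, one_smul] at this) ((w : R) • v)
  rw [smul_smul, mul_assoc, Units.inv_mul, mul_one, h v] at heq
  have hpos : 0 < f ((w : R) • v) := lt_of_le_of_ne (hf.nonneg _) hv.symm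
  refine le_antisymm (h₂1 v) ?_
  by_contra hlt
  push Not at hlt
  have : h₁ v * (f ((w : R) • v) * h₂ v) ≤ 1 * (f ((w : R) • v) * h₂ v) := by
    gcongr
    · exact mul_nonneg hpos.le (h₂0 v)
    · exact h₁1 v
  nlinarith

lemma HeydeEq.right_eq_one [Finite R] (hf : IsCharModulus f) (hg : IsCharModulus g)
    (h : HeydeEq a f g) (h4a : IsUnit (4 * a)) (v : Y) (hv : f ((4 * a) • v) ≠ 0) :
    g (((1 + a) * (2 * a)) • v) = 1 :=
  hf.eq_one_of_sq_eq (fun _ => hf.le_one _) (fun _ => hg.nonneg _)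
    (fun _ => hg.le_one _) h4a (fun v => h.left_sq hf hg v) v hv

lemma HeydeEq.left_eq_one [Finite R] (hf : IsCharModulus f) (hg : IsCharModulus g)
    (h : HeydeEq a f g) (h4a : IsUnit (4 * a)) (v : Y) (hv : g ((4 * a) • v) ≠ 0) :
    f (((1 + a) * 2) • v) = 1 :=
  hg.eq_one_of_sq_eq (fun _ => hg.le_one _) (fun _ => hf.nonneg _)
    (fun _ => hf.le_one _) h4a (fun v => h.right_sq hf hg v) v hv

lemma exists_smul_eq_of_isUnit {w : R} (hw : IsUnit w) (v : Y) : ∃ u : Y, w • u = v := by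
  obtain ⟨w, rfl⟩ := hw
  exact ⟨(↑w⁻¹ : R) • v, by rw [smul_smul, Units.mul_inv, one_smul]⟩

lemma IsCharModulus.map_natCast_smul {f : Y → ℝ} (hf : IsCharModulus f) {v : Y} (hv : f v = 1)
    (n : ℕ) : f ((n : R) • v) = 1 := by
  induction n with
  | zero => simpa using hf.map_zero
  | succ n ih =>
    rw [Nat.cast_succ, add_smul, one_smul, hf.map_add_of_eq_one _ _ ih, hv]

/-- The set where `f = 1` is closed under addition, hence under natural multiples; `hR` makes these
all the scalars. -/
lemma IsCharModulus.eq_one_smul_of {f : Y → ℝ} (hf : IsCharModulus f)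
    (hR : ∀ r : R, ∃ n : ℕ, (n : R) = r) {w : R} {v : Y} (hv : f v = 1) : f (w • v) = 1 := by
  obtain ⟨n, rfl⟩ := hR w
  exact hf.map_natCast_smul hv n

lemma IsCharModulus.eq_one_of_smul {f : Y → ℝ} (hf : IsCharModulus f)
    (hR : ∀ r : R, ∃ n : ℕ, (n : R) = r) {w : R} (hw : IsUnit w) {v : Y} (hv : f (w • v) = 1) :
    f v = 1 := by
  obtain ⟨w, rfl⟩ := hw
  have := hf.eq_one_smul_of hR (w := (↑w⁻¹ : R)) hv
  rwa [smul_smul, Units.inv_mul, one_smul] at this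

/-- If neither function vanishes, both are equal to `1` on the image of `1 + a`. -/
lemma HeydeEq.eq_one_of_ne_zero [Finite R] (hf : IsCharModulus f) (hg : IsCharModulus g)
    (h : HeydeEq a f g) (ha : IsUnit a) (h2 : IsUnit (2 : R)) (hf0 : ∀ y, f y ≠ 0)
    (hg0 : ∀ y, g y ≠ 0) (v : Y) : f ((1 + a) • v) = 1 ∧ g ((1 + a) • v) = 1 := by
  have h4a : IsUnit (4 * a) := by
    rw [show (4 : R) = 2 * 2 by norm_num]; exact (h2.mul h2).mul ha
  obtain ⟨u, rfl⟩ := exists_smul_eq_of_isUnit h2 v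
  obtain ⟨w, hw⟩ := exists_smul_eq_of_isUnit ha u
  refine ⟨?_, ?_⟩
  · rw [smul_smul]; exact h.left_eq_one hf hg h4a u (hg0 _)
  · rw [← hw, smul_smul, smul_smul, mul_assoc]; exact h.right_eq_one hf hg h4a w (hf0 _)

/-- If `1 + a` is invertible, both functions are the indicator function of the same set. -/
lemma HeydeEq.eq_one_of_isUnit [Finite R] (hR : ∀ r : R, ∃ n : ℕ, (n : R) = r)
    (hf : IsCharModulus f) (hg : IsCharModulus g) (h : HeydeEq a f g) (ha : IsUnit a)
    (h2 : IsUnit (2 : R)) (h1a : IsUnit (1 + a)) (v : Y) :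
    (f v ≠ 0 → g v = 1) ∧ (g v ≠ 0 → f v = 1) := by
  have h4a : IsUnit (4 * a) := by
    rw [show (4 : R) = 2 * 2 by norm_num]; exact (h2.mul h2).mul ha
  obtain ⟨u, rfl⟩ := exists_smul_eq_of_isUnit h4a v
  refine ⟨fun hv => ?_, fun hv => ?_⟩
  · refine hg.eq_one_of_smul hR ((h1a.mul (h2.mul ha))) (v := (4 * a) • u) ?_
    rw [smul_comm, hg.eq_one_smul_of hR (h.right_eq_one hf hg h4a u hv)]
  · refine hf.eq_one_of_smul hR (h1a.mul h2) (v := (4 * a) • u) ?_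
    rw [smul_comm, hf.eq_one_smul_of hR (h.left_eq_one hf hg h4a u hv)]

end

end

/-! ### Fourier analysis of distributions on a finite Abelian group -/

section
variable {C : Type*} [AddCommGroup C] [Fintype C]

/-- The characteristic function of a distribution on a finite Abelian group, given by its point
masses. -/
noncomputable def pointCharFn (p : C → ℝ) (y : AddChar C ℂ) : ℂ := ∑ x, (p x : ℂ) * y x

section
variable {p : C → ℝ}

lemma norm_pointCharFn_le (hp0 : ∀ x, 0 ≤ p x) (hp1 : ∑ x, p x = 1) (y : AddChar C ℂ) :
    ‖pointCharFn p y‖ ≤ 1 := by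
  rw [← hp1]
  refine (norm_sum_le _ _).trans (Finset.sum_le_sum fun x _ => ?_)
  simp [abs_of_nonneg (hp0 x)]

lemma eq_of_re_star_mul_eq_one {w z : ℂ} (hw : ‖w‖ = 1) (hz : ‖z‖ = 1)
    (h : ((starRingEnd ℂ) w * z).re = 1) : z = w := by
  have hw' : w.re * w.re + w.im * w.im = 1 := by
    rw [← Complex.normSq_apply, Complex.normSq_eq_norm_sq, hw, one_pow]
  have hz' : z.re * z.re + z.im * z.im = 1 := by
    rw [← Complex.normSq_apply, Complex.normSq_eq_norm_sq, hz, one_pow]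
  simp only [Complex.mul_re, Complex.conj_re, Complex.conj_im] at h
  have h2 : (z.re - w.re) ^ 2 + (z.im - w.im) ^ 2 = 0 := by nlinarith
  apply Complex.ext <;> nlinarith [sq_nonneg (z.re - w.re), sq_nonneg (z.im - w.im)]

/-- Equality case of the triangle inequality: an average of unit complex numbers has modulus `1`
only if they agree on the support. -/
lemma apply_eq_pointCharFn (hp0 : ∀ x, 0 ≤ p x) (hp1 : ∑ x, p x = 1) {y : AddChar C ℂ}
    (hy : ‖pointCharFn p y‖ = 1) {x : C} (hx : p x ≠ 0) : y x = pointCharFn p y := by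
  set w := pointCharFn p y with hw
  have hre : ∀ x, ((starRingEnd ℂ) w * y x).re ≤ 1 := fun x =>
    (Complex.re_le_norm _).trans (by simp [hy])
  have hsum : ∑ x, p x * (1 - ((starRingEnd ℂ) w * y x).re) = 0 := by
    have h1 : (starRingEnd ℂ) w * w = 1 := by
      rw [mul_comm, Complex.mul_conj, Complex.normSq_eq_norm_sq, hy]; simp
    have h2 : ∑ x, p x * ((starRingEnd ℂ) w * y x).re = ((starRingEnd ℂ) w * w).re := by
      rw [hw]
      conv_rhs => rw [pointCharFn, Finset.mul_sum, Complex.re_sum]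
      refine Finset.sum_congr rfl fun x _ => ?_
      rw [mul_left_comm, Complex.re_ofReal_mul, pointCharFn]
    simp only [mul_sub, mul_one, Finset.sum_sub_distrib, hp1, h2, h1, Complex.one_re, sub_self]
  have h := (Finset.sum_eq_zero_iff_of_nonneg
    (fun x _ => mul_nonneg (hp0 x) (sub_nonneg.2 (hre x)))).1 hsum x (Finset.mem_univ x)
  have h' := (mul_eq_zero.1 h).resolve_left hx
  exact eq_of_re_star_mul_eq_one hy (y.norm_apply x) (by linarith)

lemma isCharModulus_norm_pointCharFn (hp0 : ∀ x, 0 ≤ p x) (hp1 : ∑ x, p x = 1) :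
    IsCharModulus fun y => ‖pointCharFn p y‖ where
  nonneg y := norm_nonneg _
  le_one y := norm_pointCharFn_le hp0 hp1 y
  map_zero := by
    simp only [pointCharFn, AddChar.zero_apply, mul_one]
    rw [← Complex.ofReal_sum, hp1]; simp
  map_neg y := by
    rw [← Complex.norm_conj (pointCharFn p y)]
    simp only [pointCharFn, map_sum, map_mul, Complex.conj_ofReal, AddChar.neg_apply,
      AddChar.map_neg_eq_conj]
  map_add_of_eq_one y z hy := by
    have : pointCharFn p (y + z) = pointCharFn p y * pointCharFn p z := by
      conv_rhs => rw [pointCharFn.eq_1 p z, Finset.mul_sum]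
      refine Finset.sum_congr rfl fun x _ => ?_
      by_cases hx : p x = 0
      · simp [hx]
      · rw [AddChar.add_apply, apply_eq_pointCharFn hp0 hp1 hy hx]; ring
    rw [this, norm_mul, hy, one_mul]

/-- Fourier inversion, from orthogonality of characters. -/
lemma card_mul_eq_sum_pointCharFn (p : C → ℝ) (x : C) :
    (Fintype.card C : ℂ) * p x = ∑ y : AddChar C ℂ, pointCharFn p y * y (-x) := by
  classical
  simp only [pointCharFn, Finset.sum_mul]
  rw [Finset.sum_comm]
  simp only [mul_assoc, ← AddChar.map_add_eq_mul, ← Finset.mul_sum, AddChar.sum_apply_eq_ite,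
    ← sub_eq_add_neg, sub_eq_zero, mul_ite, mul_zero, Finset.sum_ite_eq', Finset.mem_univ, if_true]
  ring

/-- If the modulus of the characteristic function is the indicator function of `A`, the distribution
is uniform on a coset of the annihilator of `A`. -/
lemma uniform_of_norm_pointCharFn (hp0 : ∀ x, 0 ≤ p x) (hp1 : ∑ x, p x = 1) {A : Set (AddChar C ℂ)}
    (hA1 : ∀ y ∈ A, ‖pointCharFn p y‖ = 1) (hA0 : ∀ y ∉ A, pointCharFn p y = 0) {x₀ : C}
    (hx₀ : p x₀ ≠ 0) (x : C) :
    ((∀ y ∈ A, y (x - x₀) = 1) → p x = p x₀) ∧ ((¬∀ y ∈ A, y (x - x₀) = 1) → p x = 0) := by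
  constructor
  · intro h
    have h1 : (Fintype.card C : ℂ) * p x = (Fintype.card C : ℂ) * p x₀ := by
      rw [card_mul_eq_sum_pointCharFn, card_mul_eq_sum_pointCharFn]
      refine Finset.sum_congr rfl fun y _ => ?_
      by_cases hy : y ∈ A
      · rw [show -x₀ = (x - x₀) + -x by abel, AddChar.map_add_eq_mul, h y hy, one_mul]
      · rw [hA0 y hy, zero_mul, zero_mul]
    exact_mod_cast mul_left_cancel₀ (Nat.cast_ne_zero.2 Fintype.card_ne_zero) h1
  · intro h
    by_contra hx
    refine h fun y hy => ?_
    rw [AddChar.map_sub_eq_div, apply_eq_pointCharFn hp0 hp1 (hA1 y hy) hx,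
      apply_eq_pointCharFn hp0 hp1 (hA1 y hy) hx₀, div_self]
    rw [← norm_ne_zero_iff, hA1 y hy]
    exact one_ne_zero

end

/-! ### Solutions of the functional equation on a finite group -/

/-- The functional equation satisfied by the characteristic functions of `ξ₁` and `ξ₂`. -/
def CharFnEq (a : ℤ) (p q : C → ℝ) : Prop :=
  ∀ u v : AddChar C ℂ, pointCharFn p (u + v) * pointCharFn q (u + a • v) =
    pointCharFn p (u - v) * pointCharFn q (u - a • v)

/-- By Cauchy's theorem a prime dividing both `n` and the order of `C` would give a nonzero element
killed by `n`. -/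
lemma isUnit_zmod_of_injective {n : ℤ} (h : ∀ x : C, n • x = 0 → x = 0) :
    IsUnit (n : ZMod (Fintype.card C)) := by
  rw [ZMod.coe_int_isUnit_iff_isCoprime, Int.isCoprime_iff_gcd_eq_one]
  by_contra hgcd
  obtain ⟨r, hr, hdvd⟩ := Nat.exists_prime_and_dvd hgcd
  have : Fact r.Prime := ⟨hr⟩
  have hN : r ∣ Fintype.card C := by
    exact_mod_cast (Int.natCast_dvd_natCast.2 hdvd).trans (Int.gcd_dvd_left _ _)
  have hn : (r : ℤ) ∣ n := (Int.natCast_dvd_natCast.2 hdvd).trans (Int.gcd_dvd_right _ _)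
  obtain ⟨x, hx⟩ := exists_prime_addOrderOf_dvd_card r hN
  have hx0 := h x (addOrderOf_dvd_iff_zsmul_eq_zero.1 (hx ▸ hn))
  rw [hx0, addOrderOf_zero] at hx
  exact hr.one_lt.ne hx

section
variable {p q : C → ℝ} {a : ℤ}

lemma card_nsmul_addChar (y : AddChar C ℂ) : Fintype.card C • y = 0 := by
  ext x
  rw [AddChar.nsmul_apply, ← AddChar.map_nsmul_eq_pow, card_nsmul_eq_zero]
  simp

lemma CharFnEq.heydeEq [Module (ZMod (Fintype.card C)) (AddChar C ℂ)] (h : CharFnEq a p q) :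
    HeydeEq (a : ZMod (Fintype.card C)) (fun y => ‖pointCharFn p y‖)
      (fun y => ‖pointCharFn q y‖) := by
  intro u v
  have := congrArg norm (h u v)
  rw [norm_mul, norm_mul] at this
  simpa only [Int.cast_smul_eq_zsmul] using this

theorem CharFnEq.exists_uniform (hp0 : ∀ x, 0 ≤ p x) (hp1 : ∑ x, p x = 1) (hq0 : ∀ x, 0 ≤ q x)
    (hq1 : ∑ x, q x = 1) (h : CharFnEq a p q) (ha : ∀ x : C, a • x = 0 → x = 0)
    (h2 : ∀ x : C, (2 : ℤ) • x = 0 → x = 0) (h1a : ∀ x : C, (1 + a) • x = 0 → x = 0) :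
    ∃ G : AddSubgroup C,
      (∀ x₀ x, p x₀ ≠ 0 → (x - x₀ ∈ G → p x = p x₀) ∧ (x - x₀ ∉ G → p x = 0)) ∧
      (∀ x₀ x, q x₀ ≠ 0 → (x - x₀ ∈ G → q x = q x₀) ∧ (x - x₀ ∉ G → q x = 0)) := by
  let _ : Module (ZMod (Fintype.card C)) (AddChar C ℂ) :=
    AddCommGroup.zmodModule card_nsmul_addChar
  have : NeZero (Fintype.card C) := ⟨Fintype.card_ne_zero⟩
  have hf := isCharModulus_norm_pointCharFn hp0 hp1
  have hg := isCharModulus_norm_pointCharFn hq0 hq1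
  have key := h.heydeEq.eq_one_of_isUnit (fun r => ⟨r.val, ZMod.natCast_zmod_val r⟩) hf hg
    (isUnit_zmod_of_injective ha) (by exact_mod_cast isUnit_zmod_of_injective h2)
    (by exact_mod_cast isUnit_zmod_of_injective h1a)
  simp only [norm_ne_zero_iff] at key
  have hpq : ∀ y, ‖pointCharFn p y‖ = 1 ↔ ‖pointCharFn q y‖ = 1 := fun y =>
    ⟨fun hy => (key y).1 (by rw [← norm_ne_zero_iff, hy]; exact one_ne_zero),
      fun hy => (key y).2 (by rw [← norm_ne_zero_iff, hy]; exact one_ne_zero)⟩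
  -- `G` is the annihilator of the set where the modulus is `1`, which is the same set for `p` and
  -- `q`.
  refine ⟨{ carrier := {x | ∀ y ∈ {y | ‖pointCharFn p y‖ = 1}, y x = 1}
            zero_mem' := fun y _ => y.map_zero_eq_one
            add_mem' := fun hx hx' y hy => by
              rw [AddChar.map_add_eq_mul, hx y hy, hx' y hy, one_mul]
            neg_mem' := fun hx y hy => by rw [AddChar.map_neg_eq_inv, hx y hy, inv_one] },
    fun x₀ x hx₀ => ?_, fun x₀ x hx₀ => ?_⟩
  · refine uniform_of_norm_pointCharFn hp0 hp1 (fun y hy => hy) (fun y hy => ?_) hx₀ x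
    by_contra h0
    exact hy ((hpq y).2 ((key y).1 h0))
  · refine uniform_of_norm_pointCharFn hq0 hq1 (fun y hy => (hpq y).1 hy) (fun y hy => ?_) hx₀ x
    by_contra h0
    exact hy ((key y).2 h0)

/-- Every character `n • y` is constant on the support of `p`, and characters separate points. -/
lemma smul_sub_eq_zero_of_norm_pointCharFn (hp0 : ∀ x, 0 ≤ p x) (hp1 : ∑ x, p x = 1) {n : ℤ}
    (h : ∀ y, ‖pointCharFn p (n • y)‖ = 1) {x x' : C} (hx : p x ≠ 0) (hx' : p x' ≠ 0) :
    n • (x - x') = 0 := by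
  rw [← AddChar.forall_apply_eq_zero]
  intro y
  have h1 := apply_eq_pointCharFn hp0 hp1 (h y) hx
  have h2 := apply_eq_pointCharFn hp0 hp1 (h y) hx'
  rw [AddChar.map_zsmul_eq_zpow, ← AddChar.zsmul_apply, AddChar.map_sub_eq_div, h1, h2, div_self]
  rw [← norm_ne_zero_iff, h y]
  exact one_ne_zero

theorem CharFnEq.smul_sub_eq_zero (hp0 : ∀ x, 0 ≤ p x) (hp1 : ∑ x, p x = 1) (hq0 : ∀ x, 0 ≤ q x)
    (hq1 : ∑ x, q x = 1) (h : CharFnEq a p q) (ha : ∀ x : C, a • x = 0 → x = 0)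
    (h2 : ∀ x : C, (2 : ℤ) • x = 0 → x = 0) (hp : ∀ y, pointCharFn p y ≠ 0)
    (hq : ∀ y, pointCharFn q y ≠ 0) :
    (∀ x x', p x ≠ 0 → p x' ≠ 0 → (1 + a) • (x - x') = 0) ∧
      (∀ x x', q x ≠ 0 → q x' ≠ 0 → (1 + a) • (x - x') = 0) := by
  let _ : Module (ZMod (Fintype.card C)) (AddChar C ℂ) :=
    AddCommGroup.zmodModule card_nsmul_addChar
  have : NeZero (Fintype.card C) := ⟨Fintype.card_ne_zero⟩
  have key := h.heydeEq.eq_one_of_ne_zero (isCharModulus_norm_pointCharFn hp0 hp1)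
    (isCharModulus_norm_pointCharFn hq0 hq1)
    (isUnit_zmod_of_injective ha) (by exact_mod_cast isUnit_zmod_of_injective h2)
    (fun y => norm_ne_zero_iff.2 (hp y)) (fun y => norm_ne_zero_iff.2 (hq y))
  have hc : (1 + (a : ZMod (Fintype.card C))) = ((1 + a : ℤ) : ZMod (Fintype.card C)) := by
    push_cast; rfl
  simp only [hc, Int.cast_smul_eq_zsmul] at key
  exact ⟨fun x x' hx hx' => smul_sub_eq_zero_of_norm_pointCharFn hp0 hp1 (fun y => (key y).1) hx hx',
    fun x x' hx hx' => smul_sub_eq_zero_of_norm_pointCharFn hq0 hq1 (fun y => (key y).2) hx hx'⟩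

end

end

/-! ### Finite direct summands of the torsion group -/

section
variable {X : Type*} [AddCommGroup X]

lemma exists_generator_primaryComponent {p : ℕ}
    (hcyc : IsAddCyclic (AddCommGroup.primaryComponent X p)) :
    ∃ g : X, (∃ k : ℕ, p ^ k • g = 0) ∧
      ∀ (x : X) (k : ℕ), p ^ k • x = 0 → x ∈ AddSubgroup.zmultiples g := by
  obtain ⟨⟨g, hg⟩, h⟩ := hcyc
  refine ⟨g, hg, fun x k hx => ?_⟩
  obtain ⟨m, hm⟩ := h ⟨x, k, hx⟩
  exact ⟨m, by simpa using congrArg Subtype.val hm⟩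

/-- The elements whose orders have only prime divisors from a finite set form a cyclic group. -/
lemma exists_generator_pow_torsion
    (hcyc : ∀ p : ℕ, p.Prime → IsAddCyclic (AddCommGroup.primaryComponent X p)) (n : ℕ) :
    n ≠ 0 → ∃ g : X, (∃ k : ℕ, n ^ k • g = 0) ∧
      ∀ (x : X) (k : ℕ), n ^ k • x = 0 → x ∈ AddSubgroup.zmultiples g := by
  induction n using induction_on_primes with
  | zero => intro h; exact absurd rfl h
  | one => exact fun _ => ⟨0, ⟨0, by simp⟩, fun x k hx => by simpa using hx⟩
  | prime_mul p n hp ih =>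
    intro hpn
    obtain ⟨g, ⟨k, hk⟩, hg⟩ := ih (right_ne_zero_of_mul hpn)
    by_cases hdvd : p ∣ n
    · refine ⟨g, ⟨k, by rw [mul_pow, mul_smul, hk, smul_zero]⟩, fun x j hx => hg x (2 * j) ?_⟩
      obtain ⟨m, hm⟩ := hdvd
      have : n ^ (2 * j) = m ^ j * (p * n) ^ j := by
        rw [pow_mul, ← mul_pow]; congr 1; rw [sq]; nth_rewrite 1 [hm]; ring
      rw [this, mul_smul, hx, smul_zero]
    · have hcop : p.Coprime n := (Nat.Prime.coprime_iff_not_dvd hp).2 hdvd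
      obtain ⟨g', ⟨k', hk'⟩, hg'⟩ := exists_generator_primaryComponent (hcyc p hp)
      refine ⟨g' + g, ⟨k' + k, ?_⟩, fun x j hx => ?_⟩
      · have h1 : (p * n) ^ (k' + k) = (p ^ k * n ^ (k' + k)) * p ^ k' := by ring
        have h2 : (p * n) ^ (k' + k) = (p ^ (k' + k) * n ^ k') * n ^ k := by ring
        have h3 : (p * n) ^ (k' + k) • g' = 0 := by rw [h1, mul_smul, hk', smul_zero]
        have h4 : (p * n) ^ (k' + k) • g = 0 := by rw [h2, mul_smul, hk, smul_zero]
        rw [smul_add, h3, h4, add_zero]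
      -- A Bézout relation splits `x` into a part killed by `p ^ j` and a part killed by `n ^ j`.
      · have hj : IsCoprime ((p ^ j : ℕ) : ℤ) ((n ^ j : ℕ) : ℤ) :=
          Nat.isCoprime_iff_coprime.2 (Nat.Coprime.pow _ _ hcop)
        obtain ⟨s, t, hst⟩ := hj
        have hx' : (((p ^ j : ℕ) : ℤ) * ((n ^ j : ℕ) : ℤ)) • x = 0 := by
          rw [← Nat.cast_mul, natCast_zsmul, ← mul_pow, hx]
        obtain ⟨i₁, hi₁⟩ := hg' ((t * ((n ^ j : ℕ) : ℤ)) • x) j (by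
          rw [← natCast_zsmul, smul_smul, mul_left_comm, mul_smul, hx', smul_zero])
        obtain ⟨i₂, hi₂⟩ := hg ((s * ((p ^ j : ℕ) : ℤ)) • x) j (by
          rw [← natCast_zsmul, smul_smul, mul_left_comm, mul_comm (((n ^ j : ℕ) : ℤ)), mul_smul,
            hx', smul_zero])
        have hk2 : IsCoprime ((p ^ k' : ℕ) : ℤ) ((n ^ k : ℕ) : ℤ) :=
          Nat.isCoprime_iff_coprime.2 (Nat.Coprime.pow _ _ hcop)
        obtain ⟨s', t', hst'⟩ := hk2
        have hk0 : ((p ^ k' : ℕ) : ℤ) • g' = 0 := by rw [natCast_zsmul, hk']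
        have hk0' : ((n ^ k : ℕ) : ℤ) • g = 0 := by rw [natCast_zsmul, hk]
        simp only at hi₁ hi₂
        -- The multiplier `t' n ^ k` fixes `g'` and kills `g`, and `s' p ^ k'` does the reverse, so
        -- multiples of `g' + g` reach both parts.
        refine ⟨i₁ * (t' * ((n ^ k : ℕ) : ℤ)) + i₂ * (s' * ((p ^ k' : ℕ) : ℤ)), ?_⟩
        have e1 : (t' * ((n ^ k : ℕ) : ℤ)) • g' = g' := by
          rw [eq_sub_of_add_eq' hst', sub_smul, mul_smul s', hk0]; simp
        have e2 : (s' * ((p ^ k' : ℕ) : ℤ)) • g = g := by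
          rw [eq_sub_of_add_eq hst', sub_smul, mul_smul t', hk0']; simp
        have e3 : (t' * ((n ^ k : ℕ) : ℤ)) • g = 0 := by rw [mul_smul, hk0', smul_zero]
        have e4 : (s' * ((p ^ k' : ℕ) : ℤ)) • g' = 0 := by rw [mul_smul, hk0, smul_zero]
        simp only [smul_add, add_smul, mul_smul i₁, mul_smul i₂, e1, e2, e3, e4, smul_zero,
          add_zero, zero_add, hi₁, hi₂]
        rw [← add_smul, add_comm, hst, one_smul]

/-- A finite subset of `X` lies in a finite direct summand of `X` on which every automorphism acts as
multiplication by an integer. -/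
theorem exists_finite_retract (htors : IsAddTorsion X)
    (hcyc : ∀ p : ℕ, p.Prime → IsAddCyclic (AddCommGroup.primaryComponent X p))
    (α : X ≃+ X) (F : Finset X) :
    ∃ (C : AddSubgroup X) (_ : Finite C) (π : X →+ C) (a : ℤ), (∀ x ∈ F, x ∈ C) ∧
      (∀ c : C, π c = c) ∧ (∀ x, π (α x) = a • π x) ∧ ∀ c ∈ C, α c = a • c := by
  set n := ∏ x ∈ F, addOrderOf x with hn
  have hn0 : n ≠ 0 := Finset.prod_ne_zero_iff.2 fun x _ => (htors x).addOrderOf_pos.ne'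
  obtain ⟨g, ⟨k, hk⟩, hg⟩ := exists_generator_pow_torsion hcyc n hn0
  -- The exponent `k + 1` makes `N` kill `g` and also be divisible by `n`, so that `N` kills `F`.
  set N := n ^ (k + 1) with hN
  have hgN : N • g = 0 := by rw [hN, pow_succ', mul_smul, hk, smul_zero]
  have hker : ∀ (x : X) (j : ℕ), N ^ j • x = 0 → N • x = 0 := by
    intro x j hx
    rw [hN, ← pow_mul] at hx
    obtain ⟨m, rfl⟩ := hg x _ hx
    simp only
    rw [smul_comm, hgN, smul_zero]
  have hmem : ∀ x : X, N • x = 0 ↔ x ∈ AddSubgroup.zmultiples g := by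
    refine fun x => ⟨fun hx => hg x (k + 1) hx, ?_⟩
    rintro ⟨m, rfl⟩
    simp only
    rw [smul_comm, hgN, smul_zero]
  set φ : X →ₗ[ℤ] X := LinearMap.lsmul ℤ X (N : ℤ) with hφ
  have hφa : ∀ x, φ x = N • x := fun x => by simp [hφ]
  -- Fitting decomposition for multiplication by `N`. The kernel does not grow for powers of `N`, so
  -- it meets the range trivially; an idempotent power of `N` modulo the order of `x` splits `x`.
  have hcompl : IsCompl (LinearMap.ker φ) (LinearMap.range φ) := by
    constructor
    · rw [Submodule.disjoint_def]
      rintro x hx ⟨y, rfl⟩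
      rw [LinearMap.mem_ker] at hx
      rw [hφa]
      exact hker y 2 (by rwa [hφa, hφa, smul_smul, ← sq] at hx)
    · rw [codisjoint_iff, Submodule.eq_top_iff']
      intro x
      have hm : NeZero (addOrderOf x) := ⟨(htors x).addOrderOf_pos.ne'⟩
      obtain ⟨j, hj0, hj⟩ := exists_pow_isIdempotentElem (N : ZMod (addOrderOf x))
      have hj' : (N ^ j * N ^ j) • x = N ^ j • x := by
        rw [← sub_eq_zero, ← natCast_zsmul, ← natCast_zsmul, ← sub_smul,
          ← addOrderOf_dvd_iff_zsmul_eq_zero, ← ZMod.intCast_zmod_eq_zero_iff_dvd]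
        push_cast
        rw [hj, sub_self]
      rw [Submodule.mem_sup]
      refine ⟨x - N ^ j • x, ?_, N ^ j • x, ?_, by abel⟩
      · rw [LinearMap.mem_ker, hφa]
        refine hker _ j ?_
        rw [smul_sub, smul_smul, hj', sub_self]
      · obtain ⟨j, rfl⟩ := Nat.exists_eq_succ_of_ne_zero hj0
        exact ⟨N ^ j • x, by rw [hφa, smul_smul, pow_succ']⟩
  set C : AddSubgroup X := (LinearMap.ker φ).toAddSubgroup with hC
  have hCmem : ∀ x, x ∈ C ↔ x ∈ AddSubgroup.zmultiples g := fun x => by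
    rw [← hmem, ← hφa]; rfl
  have hCeq : C = AddSubgroup.zmultiples g := AddSubgroup.ext hCmem
  obtain ⟨a, ha⟩ : ∃ a : ℤ, a • g = α g := by
    have : α g ∈ AddSubgroup.zmultiples g := by
      rw [← hmem, ← map_nsmul, hgN, map_zero]
    exact this
  have hα : ∀ c ∈ C, α c = a • c := by
    intro c hc
    obtain ⟨m, rfl⟩ := (hCmem c).1 hc
    simp only [map_zsmul, ← ha]
    rw [smul_comm]
  let π : X →ₗ[ℤ] LinearMap.ker φ := (LinearMap.ker φ).projectionOnto _ hcompl
  have hπ : ∀ c : LinearMap.ker φ, π c = c := Submodule.projectionOnto_apply_left hcompl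
  refine ⟨C, ?_, (π.toAddMonoidHom : X →+ LinearMap.ker φ), a, fun x hx => ?_, hπ, fun x => ?_, hα⟩
  · rw [hCeq]
    exact (htors g).finite_zmultiples
  · rw [hCmem, ← hmem, hN, pow_succ, mul_smul]
    obtain ⟨m, hm⟩ : addOrderOf x ∣ n := Finset.dvd_prod_of_mem _ hx
    rw [hm, mul_comm, mul_smul, addOrderOf_nsmul_eq_zero, smul_zero, smul_zero]
  · change π (α x) = a • π x
    obtain ⟨c, hc, h, ⟨y, rfl⟩, rfl⟩ :=
      Submodule.mem_sup.1 (hcompl.sup_eq_top ▸ Submodule.mem_top : x ∈ _ ⊔ _)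
    have h1 : π (φ y) = 0 := Submodule.projectionOnto_apply_right hcompl ⟨_, y, rfl⟩
    have h2 : π (α (φ y)) = 0 :=
      Submodule.projectionOnto_apply_right hcompl ⟨_, α y, by rw [hφa, hφa, map_nsmul]⟩
    rw [map_add, map_add, map_add, h1, h2, hα c hc, map_zsmul, add_zero, add_zero]

lemma countable_of_isAddTorsion (htors : IsAddTorsion X)
    (hcyc : ∀ p : ℕ, p.Prime → IsAddCyclic (AddCommGroup.primaryComponent X p)) :
    Countable X := by
  choose g hk hg using exists_generator_pow_torsion hcyc
  rw [← Set.countable_univ_iff]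
  refine Set.Countable.mono (s₂ := ⋃ n : {n : ℕ // n ≠ 0},
    (AddSubgroup.zmultiples (g n.1 n.2) : Set X)) (fun x _ => ?_)
    (Set.countable_iUnion fun n => Set.countable_range _)
  have h0 := (htors x).addOrderOf_pos.ne'
  exact Set.mem_iUnion.2 ⟨⟨_, h0⟩, hg _ h0 x 1 (by rw [pow_one, addOrderOf_nsmul_eq_zero])⟩

end

/-! ### From conditional symmetry to the functional equation -/

section
variable {Ω : Type*} [MeasurableSpace Ω] {P : Measure Ω} [IsProbabilityMeasure P]

/-- The joint law is the composition of the law of `L₁` with the kernel, and negation changes the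
kernel only on a null set. -/
lemma CondDistribSymmetric.map_eq {X : Type*} [MeasurableSpace X] [AddCommGroup X]
    [DiscreteMeasurableSpace X] {L₂ L₁ : Ω → X} (h : CondDistribSymmetric L₂ L₁ P) :
    P.map (fun ω => (L₁ ω, L₂ ω)) = P.map (fun ω => (L₁ ω, -L₂ ω)) := by
  obtain ⟨κ, _, hκ, hsymm⟩ := h
  have hneg : Measurable fun t : X => -t := Measurable.of_discrete
  have h' := hκ.comp_left hneg
  refine hκ.map_eq.trans (Eq.trans ?_ h'.map_eq.symm)
  refine Measure.compProd_congr ?_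
  filter_upwards [hsymm] with x hx
  rw [Kernel.map_apply _ hneg, hx]

lemma pointCharFn_map {C : Type*} [AddCommGroup C] [Fintype C] [MeasurableSpace C]
    [DiscreteMeasurableSpace C] {Z : Ω → C} (hZ : Measurable Z) (y : AddChar C ℂ) :
    pointCharFn (fun c => (P.map Z).real {c}) y = ∫ ω, y (Z ω) ∂P := by
  have := Measure.isProbabilityMeasure_map (μ := P) hZ.aemeasurable
  rw [← integral_map (f := fun c => y c) hZ.aemeasurable
    (Measurable.of_discrete.aestronglyMeasurable), integral_fintype Integrable.of_finite]
  simp [pointCharFn]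

/-- Integrate `u (L₁) v (L₂)` against both joint laws; independence factors the integrals. -/
lemma charFnEq_map {C : Type*} [AddCommGroup C] [Fintype C] [MeasurableSpace C]
    [DiscreteMeasurableSpace C] {Z₁ Z₂ : Ω → C} (hZ₁ : Measurable Z₁) (hZ₂ : Measurable Z₂)
    (hind : IndepFun Z₁ Z₂ P) {a : ℤ}
    (h : P.map (fun ω => (Z₁ ω + Z₂ ω, Z₁ ω + a • Z₂ ω)) =
      P.map (fun ω => (Z₁ ω + Z₂ ω, -(Z₁ ω + a • Z₂ ω)))) :
    CharFnEq a (fun c => (P.map Z₁).real {c}) (fun c => (P.map Z₂).real {c}) := by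
  have hprod : ∀ u v : AddChar C ℂ, pointCharFn (fun c => (P.map Z₁).real {c}) u *
      pointCharFn (fun c => (P.map Z₂).real {c}) v = ∫ ω, u (Z₁ ω) * v (Z₂ ω) ∂P := by
    intro u v
    rw [pointCharFn_map hZ₁, pointCharFn_map hZ₂]
    refine (IndepFun.integral_fun_mul_eq_mul_integral
      (hind.comp (φ := u) (ψ := v) .of_discrete .of_discrete) ?_ ?_).symm
    · exact ((Measurable.of_discrete (f := u)).comp hZ₁).aestronglyMeasurable
    · exact ((Measurable.of_discrete (f := v)).comp hZ₂).aestronglyMeasurable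
  have hpair : Measurable fun ω => (Z₁ ω, Z₂ ω) := hZ₁.prodMk hZ₂
  have hm₁ : Measurable (fun ω => (Z₁ ω + Z₂ ω, Z₁ ω + a • Z₂ ω)) :=
    (Measurable.of_discrete (f := fun z : C × C => (z.1 + z.2, z.1 + a • z.2))).comp hpair
  have hm₂ : Measurable (fun ω => (Z₁ ω + Z₂ ω, -(Z₁ ω + a • Z₂ ω))) :=
    (Measurable.of_discrete (f := fun z : C × C => (z.1 + z.2, -(z.1 + a • z.2)))).comp hpair
  intro u v
  have := congrArg (fun ρ : Measure (C × C) => ∫ z, u z.1 * v z.2 ∂ρ) h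
  rw [integral_map hm₁.aemeasurable Measurable.of_discrete.aestronglyMeasurable,
    integral_map hm₂.aemeasurable Measurable.of_discrete.aestronglyMeasurable] at this
  rw [hprod, hprod]
  convert this using 3 with ω ω
  · simp only [AddChar.map_add_eq_mul, AddChar.add_apply, AddChar.zsmul_apply,
      AddChar.map_zsmul_eq_zpow]
    ring
  · simp only [AddChar.map_add_eq_mul, AddChar.sub_apply', AddChar.zsmul_apply, neg_add,
      AddChar.map_neg_eq_inv, AddChar.map_zsmul_eq_zpow, div_eq_mul_inv]
    ring

end

/-! ### Uniform distributions on a countable set -/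

section
variable {X : Type*} [MeasurableSpace X] [DiscreteMeasurableSpace X] [Countable X]

lemma exists_finset_measureReal_compl_lt (μ : Measure X) [IsFiniteMeasure μ] (F₀ : Finset X) {ε : ℝ}
    (hε : 0 < ε) : ∃ F : Finset X, F₀ ⊆ F ∧ μ.real (F : Set X)ᶜ < ε := by
  have hsum : ∑' x : X, μ {x} ≠ ⊤ := by
    have := tsum_measure_preimage_singleton (μ := μ) (s := Set.univ) (f := id) Set.countable_univ
      (fun _ _ => .of_discrete)
    rw [tsum_univ (f := fun b => μ (id ⁻¹' {b}))] at this
    simp only [Set.preimage_id] at this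
    rw [this]; exact measure_ne_top _ _
  have h := ENNReal.tendsto_tsum_compl_atTop_zero hsum
  obtain ⟨F, hF, hF0⟩ := ((h.eventually_lt_const (ENNReal.ofReal_pos.2 hε)).and
    (Filter.eventually_ge_atTop F₀)).exists
  refine ⟨F, hF0, ?_⟩
  rw [measureReal_def, ← ENNReal.lt_ofReal_iff_toReal_lt (measure_ne_top _ _)]
  refine lt_of_le_of_lt ?_ hF
  have : (F : Set X)ᶜ = ⋃ b : {x // x ∉ F}, {(b : X)} := by ext; simp
  rw [this]
  exact measure_iUnion_le _

/-- If arbitrarily fine finite quotients of a distribution are uniform on their supports, so is the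
distribution. -/
lemma measureReal_singleton_eq_of_retract (μ : Measure X) [IsProbabilityMeasure μ]
    (h : ∀ F : Finset X, ∃ π : X → X, (∀ x ∈ F, π x = x) ∧ ∀ x y, μ.real (π ⁻¹' {π x}) ≠ 0 →
      μ.real (π ⁻¹' {π y}) ≠ 0 → μ.real (π ⁻¹' {π x}) = μ.real (π ⁻¹' {π y}))
    {x y : X} (hx : μ.real {x} ≠ 0) (hy : μ.real {y} ≠ 0) : μ.real {x} = μ.real {y} := by
  classical
  wlog hle : μ.real {y} < μ.real {x} generalizing x y
  · by_contra hne
    exact hne (this hy hx (lt_of_le_of_ne (not_lt.1 hle) hne)).symm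
  exfalso
  -- With this bound the fibre through `y`, contained in `{y} ∪ Fᶜ`, has mass below `μ {x}`, whereas
  -- it must equal the fibre through `x`.
  obtain ⟨F, hF0, hF⟩ := exists_finset_measureReal_compl_lt μ {y} (sub_pos.2 hle)
  obtain ⟨π, hπ, hu⟩ := h F
  have hpos : ∀ z, μ.real {z} ≤ μ.real (π ⁻¹' {π z}) := fun z =>
    measureReal_mono (by simp)
  have hne : ∀ z, μ.real {z} ≠ 0 → μ.real (π ⁻¹' {π z}) ≠ 0 := fun z hz =>
    ((lt_of_le_of_ne measureReal_nonneg hz.symm).trans_le (hpos z)).ne'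
  have h1 : μ.real {x} ≤ μ.real (π ⁻¹' {π y}) := (hpos x).trans (hu x y (hne x hx) (hne y hy)).le
  have h2 : π ⁻¹' {π y} ⊆ {y} ∪ (F : Set X)ᶜ := by
    intro z hz
    by_cases hzF : z ∈ F
    · left
      rw [Set.mem_preimage, Set.mem_singleton_iff, hπ z hzF,
        hπ y (hF0 (Finset.mem_singleton_self y))] at hz
      exact hz
    · right; simpa using hzF
  have h3 := (measureReal_mono (μ := μ) h2).trans (measureReal_union_le _ _)
  linarith

lemma finite_setOf_measureReal_ne_zero (μ : Measure X) [IsProbabilityMeasure μ]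
    (h : ∀ x y, μ.real {x} ≠ 0 → μ.real {y} ≠ 0 → μ.real {x} = μ.real {y}) :
    {x | μ.real {x} ≠ 0}.Finite := by
  by_contra hinf
  obtain ⟨x₀, hx₀⟩ := Set.Infinite.nonempty hinf
  have hpos : 0 < μ.real {x₀} := lt_of_le_of_ne measureReal_nonneg (Ne.symm hx₀)
  obtain ⟨n, hn⟩ := exists_nat_gt (1 / μ.real {x₀})
  obtain ⟨t, ht, hcard⟩ := Set.Infinite.exists_subset_card_eq hinf n
  have h1 := sum_measureReal_singleton (μ := μ) t
  rw [Finset.sum_congr rfl (fun x hx => h x x₀ (ht hx) hx₀), Finset.sum_const, hcard,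
    nsmul_eq_mul] at h1
  rw [div_lt_iff₀ hpos] at hn
  linarith [measureReal_le_one (μ := μ) (s := (t : Set X))]

omit [DiscreteMeasurableSpace X] in
lemma exists_measureReal_singleton_ne_zero (μ : Measure X) [IsProbabilityMeasure μ] :
    ∃ x, μ.real {x} ≠ 0 := by
  by_contra! h
  have : μ = 0 := Measure.ext_of_singleton fun a => by
    simpa [measureReal_def, ENNReal.toReal_eq_zero_iff] using h a
  exact IsProbabilityMeasure.ne_zero μ this

omit [DiscreteMeasurableSpace X] in
lemma ae_measureReal_singleton_ne_zero (μ : Measure X) [IsFiniteMeasure μ] :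
    ∀ᵐ x ∂μ, μ.real {x} ≠ 0 := by
  rw [ae_iff, ← Set.biUnion_of_singleton {a | ¬μ.real {a} ≠ 0},
    measure_biUnion_null_iff (Set.to_countable _)]
  intro x hx
  simpa [measureReal_def, ENNReal.toReal_eq_zero_iff] using hx

lemma measure_eq_of_uniform (μ ν : Measure X) [IsProbabilityMeasure μ] [IsProbabilityMeasure ν]
    (T : Finset X) {m m' : ℝ} (hμ : ∀ x ∈ T, μ.real {x} = m) (hν : ∀ x ∈ T, ν.real {x} = m')
    (hμ0 : ∀ x ∉ T, μ.real {x} = 0) (hν0 : ∀ x ∉ T, ν.real {x} = 0) : μ = ν := by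
  have key : ∀ (ρ : Measure X) [IsProbabilityMeasure ρ] (r : ℝ), (∀ x ∈ T, ρ.real {x} = r) →
      (∀ x ∉ T, ρ.real {x} = 0) → T.card * r = 1 := by
    intro ρ _ r h h0
    rw [← nsmul_eq_mul, ← Finset.sum_const, ← Finset.sum_congr rfl h, sum_measureReal_singleton,
      ← probReal_univ (μ := ρ), ← sub_eq_zero, ← neg_eq_zero, neg_sub,
      ← measureReal_compl T.measurableSet, measureReal_def]
    have : ρ (T : Set X)ᶜ = 0 := by
      rw [← Set.biUnion_of_singleton (T : Set X)ᶜ, measure_biUnion_null_iff (Set.to_countable _)]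
      intro x hx
      simpa [measureReal_def, ENNReal.toReal_eq_zero_iff] using h0 x hx
    rw [this, ENNReal.toReal_zero]
  have h1 := key μ m hμ hμ0
  have h2 := key ν m' hν hν0
  have hm : m = m' := by
    have : (T.card : ℝ) ≠ 0 := fun h => by rw [h, zero_mul] at h1; exact zero_ne_one h1
    exact mul_left_cancel₀ this (h1.trans h2.symm)
  refine Measure.ext_of_singleton fun x => (measureReal_eq_measureReal_iff).1 ?_
  by_cases hx : x ∈ T
  · rw [hμ x hx, hν x hx, hm]
  · rw [hμ0 x hx, hν0 x hx]

end

/-! ### Haar distributions of finite subgroups -/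

section
variable {X : Type*} [AddCommGroup X] [TopologicalSpace X] [DiscreteTopology X]
  [MeasurableSpace X] [BorelSpace X]

lemma discreteMeasurableSpace_of_borelSpace (X : Type*) [TopologicalSpace X] [DiscreteTopology X]
    [MeasurableSpace X] [BorelSpace X] : DiscreteMeasurableSpace X :=
  ⟨fun s => (isOpen_discrete s).measurableSet⟩

lemma isShift_haarDistribution_of_uniform [Countable X] (μ : Measure X) [IsProbabilityMeasure μ]
    (G : AddSubgroup X) [Finite G] (x₀ : X)
    (h1 : ∀ x, x - x₀ ∈ G → μ.real {x} = μ.real {x₀}) (h0 : ∀ x, x - x₀ ∉ G → μ.real {x} = 0) :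
    IsShift μ (haarDistribution G) := by
  classical
  have := discreteMeasurableSpace_of_borelSpace X
  have := discreteMeasurableSpace_of_borelSpace G
  set H : Measure G := Measure.addHaarMeasure ⊤ with hH
  have : IsProbabilityMeasure H := ⟨by
    simpa using Measure.addHaarMeasure_self (K₀ := (⊤ : TopologicalSpace.PositiveCompacts G))⟩
  have hHs : ∀ g : G, H {g} = H {0} := fun g => by
    rw [← measure_preimage_add H g {g}]
    congr 1; ext; simp
  set T : Finset X := (Set.toFinite ((fun t => x₀ + t) '' (G : Set X))).toFinset with hT
  have hmemT : ∀ x, x ∈ T ↔ x - x₀ ∈ G := fun x => by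
    simp only [hT, Set.Finite.mem_toFinset, Set.mem_image, SetLike.mem_coe]
    exact ⟨by rintro ⟨t, ht, rfl⟩; simpa using ht, fun h => ⟨_, h, by abel⟩⟩
  have hHeq : (haarDistribution G).map (fun t => x₀ + t) = H.map (fun g : G => x₀ + (g : X)) := by
    rw [haarDistribution, Measure.map_map .of_discrete .of_discrete]; rfl
  have hprob : IsProbabilityMeasure ((haarDistribution G).map (fun t => x₀ + t)) := by
    rw [hHeq]; exact Measure.isProbabilityMeasure_map Measurable.of_discrete.aemeasurable
  refine ⟨x₀, measure_eq_of_uniform _ _ T (m' := H.real {0}) (fun x hx => h1 x ((hmemT x).1 hx))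
    (fun x hx => ?_) (fun x hx => h0 x (mt (hmemT x).2 hx)) fun x hx => ?_⟩
  · rw [hHeq, measureReal_def, Measure.map_apply .of_discrete .of_discrete, measureReal_def,
      ← hHs ⟨x - x₀, (hmemT x).1 hx⟩]
    congr 2
    ext g
    simp [Subtype.ext_iff, eq_sub_iff_add_eq']
  · rw [hHeq, measureReal_def, Measure.map_apply .of_discrete .of_discrete]
    have : (fun g : G => x₀ + (g : X)) ⁻¹' {x} = ∅ := by
      ext g
      simp only [Set.mem_preimage, Set.mem_singleton_iff, Set.mem_empty_iff_false, iff_false]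
      rintro rfl
      exact hx ((hmemT _).2 (by simp))
    rw [this]; simp

end

/-! ### Transfer between the group and its finite summands -/

section
variable {X : Type*} [AddCommGroup X] [MeasurableSpace X] [DiscreteMeasurableSpace X] [Countable X]
  {Ω : Type*} [MeasurableSpace Ω] {P : Measure Ω} [IsProbabilityMeasure P] {ξ₁ ξ₂ : Ω → X}
  {α : X ≃+ X}

lemma charFnEq_comp (hξ₁ : Measurable ξ₁) (hξ₂ : Measurable ξ₂) (hindep : IndepFun ξ₁ ξ₂ P)
    (hsymm : CondDistribSymmetric (fun ω => ξ₁ ω + α (ξ₂ ω)) (fun ω => ξ₁ ω + ξ₂ ω) P)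
    {C : Type*} [AddCommGroup C] [Fintype C] [MeasurableSpace C] [DiscreteMeasurableSpace C]
    (π : X →+ C) {a : ℤ} (hπ : ∀ x, π (α x) = a • π x) :
    CharFnEq a (fun c => (P.map (fun ω => π (ξ₁ ω))).real {c})
      (fun c => (P.map (fun ω => π (ξ₂ ω))).real {c}) := by
  have hπm : Measurable π := .of_discrete
  have hpair : Measurable fun ω => (ξ₁ ω, ξ₂ ω) := hξ₁.prodMk hξ₂
  refine charFnEq_map (hπm.comp hξ₁) (hπm.comp hξ₂) (hindep.comp hπm hπm) ?_
  have hm₁ : Measurable (fun ω => (ξ₁ ω + ξ₂ ω, ξ₁ ω + α (ξ₂ ω))) :=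
    (Measurable.of_discrete (f := fun z : X × X => (z.1 + z.2, z.1 + α z.2))).comp hpair
  have hm₂ : Measurable (fun ω => (ξ₁ ω + ξ₂ ω, -(ξ₁ ω + α (ξ₂ ω)))) :=
    (Measurable.of_discrete (f := fun z : X × X => (z.1 + z.2, -(z.1 + α z.2)))).comp hpair
  have h := congrArg (fun ρ : Measure (X × X) => ρ.map (Prod.map π π)) hsymm.map_eq
  simp only [Measure.map_map (hπm.prodMap hπm) hm₁, Measure.map_map (hπm.prodMap hπm) hm₂] at h
  convert h using 2
  · ext ω <;> simp [hπ]
  · ext ω <;> simp [hπ]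

lemma sum_measureReal_map {C : Type*} [Fintype C] [MeasurableSpace C] [DiscreteMeasurableSpace C]
    {Z : Ω → C} (hZ : Measurable Z) : ∑ c, (P.map Z).real {c} = 1 := by
  have := Measure.isProbabilityMeasure_map (μ := P) hZ.aemeasurable
  rw [sum_measureReal_singleton, Finset.coe_univ, probReal_univ]

omit [AddCommGroup X] [Countable X] [IsProbabilityMeasure P] in
lemma measureReal_map_comp {C : Type*} [MeasurableSpace C] [DiscreteMeasurableSpace C]
    (hξ₁ : Measurable ξ₁) (π : X → C) (c : C) :
    (P.map (fun ω => π (ξ₁ ω))).real {c} = (P.map ξ₁).real (π ⁻¹' {c}) := by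
  rw [measureReal_def, measureReal_def, Measure.map_apply hξ₁ .of_discrete,
    Measure.map_apply (f := fun ω => π (ξ₁ ω)) ((Measurable.of_discrete (f := π)).comp hξ₁)
      .of_discrete]
  rfl

lemma eq_zero_of_two_zsmul {X : Type*} [AddCommGroup X] (htwo : ∀ x : X, addOrderOf x ≠ 2) {x : X}
    (hx : (2 : ℤ) • x = 0) : x = 0 := by
  by_contra h
  exact htwo x (addOrderOf_eq_prime (by exact_mod_cast hx) h)

lemma mem_kerOneAdd {X : Type*} [AddCommGroup X] {α : X ≃+ X} {x : X} :
    x ∈ kerOneAdd α ↔ x + α x = 0 := Iff.rfl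

/-- Both distributions are uniform on cosets of the same finite subgroup after projection to a
finite summand. -/
lemma exists_uniform_retract (htors : IsAddTorsion X)
    (hcyc : ∀ p : ℕ, p.Prime → IsAddCyclic (AddCommGroup.primaryComponent X p))
    (htwo : ∀ x : X, addOrderOf x ≠ 2) (hξ₁ : Measurable ξ₁) (hξ₂ : Measurable ξ₂)
    (hindep : IndepFun ξ₁ ξ₂ P)
    (hsymm : CondDistribSymmetric (fun ω => ξ₁ ω + α (ξ₂ ω)) (fun ω => ξ₁ ω + ξ₂ ω) P)
    (hker : kerOneAdd α = ⊥) (F : Finset X) :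
    ∃ (C : AddSubgroup X) (_ : Finite C) (π : X →+ C) (G : AddSubgroup C), (∀ x ∈ F, x ∈ C) ∧
      (∀ c : C, π c = c) ∧
      (∀ x₀ x : C, (P.map ξ₁).real (π ⁻¹' {x₀}) ≠ 0 →
        (x - x₀ ∈ G → (P.map ξ₁).real (π ⁻¹' {x}) = (P.map ξ₁).real (π ⁻¹' {x₀})) ∧
          (x - x₀ ∉ G → (P.map ξ₁).real (π ⁻¹' {x}) = 0)) ∧
      (∀ x₀ x : C, (P.map ξ₂).real (π ⁻¹' {x₀}) ≠ 0 →
        (x - x₀ ∈ G → (P.map ξ₂).real (π ⁻¹' {x}) = (P.map ξ₂).real (π ⁻¹' {x₀})) ∧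
          (x - x₀ ∉ G → (P.map ξ₂).real (π ⁻¹' {x}) = 0)) := by
  obtain ⟨C, hC, π, a, hF, hπ, hπα, hα⟩ := exists_finite_retract htors hcyc α F
  have := Fintype.ofFinite C
  have hm : ∀ ξ : Ω → X, Measurable ξ → Measurable fun ω => π (ξ ω) := fun ξ hξ =>
    (Measurable.of_discrete (f := π)).comp hξ
  obtain ⟨G, h₁, h₂⟩ := (charFnEq_comp hξ₁ hξ₂ hindep hsymm π hπα).exists_uniform
    (fun _ => measureReal_nonneg) (sum_measureReal_map (hm _ hξ₁))
    (fun _ => measureReal_nonneg) (sum_measureReal_map (hm _ hξ₂))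
    (fun c hc => Subtype.ext <| α.map_eq_zero_iff.1 <| by
      rw [hα c c.2]; exact congrArg Subtype.val hc)
    (fun c hc => Subtype.ext <| eq_zero_of_two_zsmul htwo <| congrArg Subtype.val hc)
    (fun c hc => Subtype.ext <| by
      rw [ZeroMemClass.coe_zero, ← AddSubgroup.mem_bot, ← hker, mem_kerOneAdd, hα c c.2]
      have := congrArg Subtype.val hc
      rw [add_smul, one_smul] at this
      exact this)
  simp only [measureReal_map_comp hξ₁, measureReal_map_comp hξ₂] at h₁ h₂
  exact ⟨C, hC, π, G, hF, hπ, h₁, h₂⟩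

-- A character of `C` composed with `π` is a character of `X`, so nonvanishing passes to the
-- projection.
omit [Countable X] in
lemma pointCharFn_comp_ne_zero (hξ : Measurable ξ₁)
    (hne : ∀ y : AddChar X Circle, charFn (P.map ξ₁) y ≠ 0)
    {C : Type*} [AddCommGroup C] [Fintype C] [MeasurableSpace C] [DiscreteMeasurableSpace C]
    (π : X →+ C) (y : AddChar C ℂ) :
    pointCharFn (fun c => (P.map (fun ω => π (ξ₁ ω))).real {c}) y ≠ 0 := by
  have hπm : Measurable π := .of_discrete
  rw [pointCharFn_map (Z := fun ω => π (ξ₁ ω)) (hπm.comp hξ)]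
  have := hne ((AddChar.circleEquivComplex.symm y).compAddMonoidHom π)
  rw [charFn, integral_map hξ.aemeasurable Measurable.of_discrete.aestronglyMeasurable] at this
  exact this

/-- If the characteristic functions do not vanish, both distributions are supported in cosets of
`Ker (I + α)`. -/
lemma sub_mem_kerOneAdd (htors : IsAddTorsion X)
    (hcyc : ∀ p : ℕ, p.Prime → IsAddCyclic (AddCommGroup.primaryComponent X p))
    (htwo : ∀ x : X, addOrderOf x ≠ 2) (hξ₁ : Measurable ξ₁) (hξ₂ : Measurable ξ₂)
    (hindep : IndepFun ξ₁ ξ₂ P)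
    (hsymm : CondDistribSymmetric (fun ω => ξ₁ ω + α (ξ₂ ω)) (fun ω => ξ₁ ω + ξ₂ ω) P)
    (hne₁ : ∀ y : AddChar X Circle, charFn (P.map ξ₁) y ≠ 0)
    (hne₂ : ∀ y : AddChar X Circle, charFn (P.map ξ₂) y ≠ 0) (x x' : X) :
    ((P.map ξ₁).real {x} ≠ 0 → (P.map ξ₁).real {x'} ≠ 0 → x - x' ∈ kerOneAdd α) ∧
      ((P.map ξ₂).real {x} ≠ 0 → (P.map ξ₂).real {x'} ≠ 0 → x - x' ∈ kerOneAdd α) := by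
  classical
  obtain ⟨C, hC, π, a, hF, hπ, hπα, hα⟩ := exists_finite_retract htors hcyc α {x, x'}
  have := Fintype.ofFinite C
  have hm : ∀ ξ : Ω → X, Measurable ξ → Measurable fun ω => π (ξ ω) := fun ξ hξ =>
    (Measurable.of_discrete (f := π)).comp hξ
  obtain ⟨h₁, h₂⟩ := (charFnEq_comp hξ₁ hξ₂ hindep hsymm π hπα).smul_sub_eq_zero
    (fun _ => measureReal_nonneg) (sum_measureReal_map (hm _ hξ₁))
    (fun _ => measureReal_nonneg) (sum_measureReal_map (hm _ hξ₂))
    (fun c hc => Subtype.ext <| α.map_eq_zero_iff.1 <| by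
      rw [hα c c.2]; exact congrArg Subtype.val hc)
    (fun c hc => Subtype.ext <| eq_zero_of_two_zsmul htwo <| congrArg Subtype.val hc)
    (pointCharFn_comp_ne_zero hξ₁ hne₁ π) (pointCharFn_comp_ne_zero hξ₂ hne₂ π)
  simp only [measureReal_map_comp hξ₁, measureReal_map_comp hξ₂] at h₁ h₂
  have hx : x ∈ C := hF x (by simp)
  have hx' : x' ∈ C := hF x' (by simp)
  have hpos : ∀ (ξ : Ω → X) (z : X) (hz : z ∈ C), Measurable ξ → (P.map ξ).real {z} ≠ 0 →
      (P.map ξ).real (π ⁻¹' {⟨z, hz⟩}) ≠ 0 := by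
    intro ξ z hz hξ h
    have := Measure.isProbabilityMeasure_map (μ := P) hξ.aemeasurable
    refine ((lt_of_le_of_ne measureReal_nonneg h.symm).trans_le (measureReal_mono ?_)).ne'
    rw [Set.singleton_subset_iff]
    exact hπ ⟨z, hz⟩
  have hk : (1 + a) • ((⟨x, hx⟩ : C) - ⟨x', hx'⟩) = 0 → x - x' ∈ kerOneAdd α := by
    intro h
    have := congrArg Subtype.val h
    rw [add_smul, one_smul] at this
    rw [mem_kerOneAdd, hα _ (sub_mem hx hx')]
    exact this
  exact ⟨fun h h' => hk (h₁ _ _ (hpos ξ₁ x hx hξ₁ h) (hpos ξ₁ x' hx' hξ₁ h')),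
    fun h h' => hk (h₂ _ _ (hpos ξ₂ x hx hξ₂ h) (hpos ξ₂ x' hx' hξ₂ h'))⟩

/-- If two independent random variables are supported in cosets of `Ker (I + α)`, the symmetry of the
conditional distribution implies that their distributions are shifts of one another. -/
lemma exists_common_shift (htwo : ∀ x : X, addOrderOf x ≠ 2) (hξ₁ : Measurable ξ₁)
    (hξ₂ : Measurable ξ₂) (hindep : IndepFun ξ₁ ξ₂ P)
    (hsymm : CondDistribSymmetric (fun ω => ξ₁ ω + α (ξ₂ ω)) (fun ω => ξ₁ ω + ξ₂ ω) P)
    (hk₁ : ∀ x x', (P.map ξ₁).real {x} ≠ 0 → (P.map ξ₁).real {x'} ≠ 0 → x - x' ∈ kerOneAdd α)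
    (hk₂ : ∀ x x', (P.map ξ₂).real {x} ≠ 0 → (P.map ξ₂).real {x'} ≠ 0 → x - x' ∈ kerOneAdd α) :
    ∃ ν : Measure X, IsProbabilityMeasure ν ∧ ν (kerOneAdd α : Set X)ᶜ = 0 ∧
      IsShift (P.map ξ₁) ν ∧ IsShift (P.map ξ₂) ν := by
  have hP₁ := Measure.isProbabilityMeasure_map (μ := P) hξ₁.aemeasurable
  have hP₂ := Measure.isProbabilityMeasure_map (μ := P) hξ₂.aemeasurable
  obtain ⟨x₀, hx₀⟩ := exists_measureReal_singleton_ne_zero (P.map ξ₁)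
  obtain ⟨y₀, hy₀⟩ := exists_measureReal_singleton_ne_zero (P.map ξ₂)
  have hpair : Measurable fun ω => (ξ₁ ω, ξ₂ ω) := hξ₁.prodMk hξ₂
  have hm₁ : Measurable (fun ω => (ξ₁ ω + ξ₂ ω, ξ₁ ω + α (ξ₂ ω))) :=
    (Measurable.of_discrete (f := fun z : X × X => (z.1 + z.2, z.1 + α z.2))).comp hpair
  have hm₂ : Measurable (fun ω => (ξ₁ ω + ξ₂ ω, -(ξ₁ ω + α (ξ₂ ω)))) :=
    (Measurable.of_discrete (f := fun z : X × X => (z.1 + z.2, -(z.1 + α z.2)))).comp hpair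
  have hae₁ := ae_of_ae_map hξ₁.aemeasurable (ae_measureReal_singleton_ne_zero (P.map ξ₁))
  have hae₂ := ae_of_ae_map hξ₂.aemeasurable (ae_measureReal_singleton_ne_zero (P.map ξ₂))
  -- a point of the support at which the second form vanishes
  obtain ⟨x₁, hx₁, hx₁y₀⟩ : ∃ x₁, (P.map ξ₁).real {x₁} ≠ 0 ∧ x₁ + α y₀ = 0 := by
    -- This atom of `(L₁, L₂)` is also an atom of `(L₁, -L₂)`. A sample point realising the latter,
    -- with `ξ₂ - y₀` in the kernel, satisfies `2 (ξ₁ + α y₀) = 0`.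
    have hpos : P.map (fun ω => (ξ₁ ω + ξ₂ ω, ξ₁ ω + α (ξ₂ ω))) {(x₀ + y₀, x₀ + α y₀)} ≠ 0 := by
      rw [Measure.map_apply hm₁ .of_discrete]
      have h1 : P (ξ₁ ⁻¹' {x₀} ∩ ξ₂ ⁻¹' {y₀}) ≠ 0 := by
        rw [hindep.measure_inter_preimage_eq_mul _ _ .of_discrete .of_discrete,
          ← Measure.map_apply hξ₁ .of_discrete, ← Measure.map_apply hξ₂ .of_discrete]
        exact mul_ne_zero (fun h => hx₀ (by simp [measureReal_def, h]))
          (fun h => hy₀ (by simp [measureReal_def, h]))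
      refine fun h => h1 (measure_mono_null ?_ h)
      rintro ω ⟨h, h'⟩
      simp only [Set.mem_preimage, Set.mem_singleton_iff] at h h' ⊢
      rw [h, h']
    rw [hsymm.map_eq, Measure.map_apply hm₂ .of_discrete] at hpos
    obtain ⟨ω, hω, h₁, h₂⟩ := (Filter.Frequently.and_eventually
      (frequently_ae_mem_iff.2 hpos) (hae₁.and hae₂)).exists
    simp only [Set.mem_preimage, Set.mem_singleton_iff, Prod.mk.injEq] at hω
    refine ⟨ξ₁ ω, h₁, ?_⟩
    have hk := mem_kerOneAdd.1 (hk₂ _ _ h₂ hy₀)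
    apply eq_zero_of_two_zsmul htwo
    have e1 := hω.1
    have e2 := hω.2
    rw [map_sub] at hk
    have e3 : ξ₁ ω = x₀ + y₀ - ξ₂ ω := eq_sub_of_add_eq e1
    have e4 : α (ξ₂ ω) = α y₀ - (ξ₂ ω - y₀) := by
      rw [← sub_eq_zero, ← hk]; abel
    rw [e4, e3] at e2
    rw [e3]
    have e5 : (2 : ℤ) • (x₀ + y₀ - ξ₂ ω + α y₀) =
      (x₀ + α y₀) - -(x₀ + y₀ - ξ₂ ω + (α y₀ - (ξ₂ ω - y₀))) := by abel
    rw [e5, e2, sub_self]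
  have hκ₁ : ∀ᵐ ω ∂P, ξ₁ ω - x₁ ∈ kerOneAdd α := hae₁.mono fun ω h => hk₁ _ _ h hx₁
  have hκ₂ : ∀ᵐ ω ∂P, ξ₂ ω - y₀ ∈ kerOneAdd α := hae₂.mono fun ω h => hk₂ _ _ h hy₀
  have hd : Measurable fun x : X => (2 : ℤ) • x := .of_discrete
  have hs : ∀ x, Measurable fun t : X => t - x := fun x => .of_discrete
  -- Since `x₁ + α y₀ = 0`, almost surely `L₁ + L₂ - (x₁ + y₀) = 2 (ξ₁ - x₁)` and `L₁ - L₂ - (x₁ +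
  -- y₀) = 2 (ξ₂ - y₀)`. These have equal laws, and doubling is injective.
  have hκ : (P.map ξ₁).map (fun t => t - x₁) = (P.map ξ₂).map (fun t => t - y₀) := by
    have hinj : Function.Injective fun x : X => (2 : ℤ) • x := fun x y h =>
      sub_eq_zero.1 (eq_zero_of_two_zsmul htwo (by rw [smul_sub]; exact sub_eq_zero.2 h))
    have hemb : MeasurableEmbedding fun x : X => (2 : ℤ) • x :=
      ⟨hinj, hd, fun _ _ => .of_discrete⟩
    apply hemb.map_injective
    have hg : Measurable fun z : X × X => z.1 + z.2 - (x₁ + y₀) := .of_discrete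
    have h := congrArg (fun ρ : Measure (X × X) => ρ.map fun z => z.1 + z.2 - (x₁ + y₀))
      hsymm.map_eq
    simp only [Measure.map_map hg hm₁, Measure.map_map hg hm₂] at h
    rw [Measure.map_map (hs x₁) hξ₁, Measure.map_map (hs y₀) hξ₂,
      Measure.map_map hd ((hs x₁).comp hξ₁), Measure.map_map hd ((hs y₀).comp hξ₂)]
    have hform : ∀ ω, ξ₂ ω - y₀ ∈ kerOneAdd α → α (ξ₂ ω) = -x₁ - (ξ₂ ω - y₀) := fun ω hω => by
      have hk := mem_kerOneAdd.1 hω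
      rw [map_sub] at hk
      rw [eq_neg_of_add_eq_zero_left hx₁y₀, neg_neg, ← sub_eq_zero, ← hk]
      abel
    refine Eq.trans (Measure.map_congr ?_) (h.trans (Measure.map_congr ?_))
    · filter_upwards [hκ₂] with ω hω
      simp only [Function.comp_apply, hform ω hω]
      abel
    · filter_upwards [hκ₂] with ω hω
      simp only [Function.comp_apply, hform ω hω]
      abel
  have hback : ∀ (μ : Measure X) (x : X), μ = (μ.map fun t => t - x).map fun t => x + t := by
    intro μ x
    rw [Measure.map_map .of_discrete (hs x)]
    have : (fun t => x + t) ∘ (fun t : X => t - x) = id := by ext t; simp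
    rw [this, Measure.map_id]
  refine ⟨(P.map ξ₁).map (fun t => t - x₁), Measure.isProbabilityMeasure_map (hs x₁).aemeasurable,
    ?_, ⟨x₁, hback _ _⟩, ⟨y₀, ?_⟩⟩
  · rw [Measure.map_map (hs x₁) hξ₁, Measure.map_apply ((hs x₁).comp hξ₁) .of_discrete]
    exact hκ₁
  · rw [hκ]; exact hback _ _

omit [DiscreteMeasurableSpace X] in
/-- The measure of a fibre of a retraction onto a subgroup containing the support. -/
lemma measureReal_preimage_retract {μ : Measure X} [IsFiniteMeasure μ] {C : AddSubgroup X}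
    {π : X →+ C}
    (hπ : ∀ c : C, π c = c) (hC : ∀ x, μ.real {x} ≠ 0 → x ∈ C) (c : C) :
    μ.real (π ⁻¹' {c}) = μ.real {(c : X)} := by
  refine measureReal_congr ?_
  have h : ∀ᵐ x ∂μ, x ∈ C := (ae_measureReal_singleton_ne_zero μ).mono hC
  filter_upwards [h] with x hx
  refine propext ⟨fun h => ?_, fun h => ?_⟩
  · have h' : π x = c := h
    rw [← h', hπ ⟨x, hx⟩]; rfl
  · have h' : x = c := h
    rw [h']; exact hπ c

omit [DiscreteMeasurableSpace X] [Countable X] in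
/-- The conclusion for one distribution of `exists_uniform_retract`, in terms of a map from `X` to
itself. -/
lemma exists_retract_of_uniform {μ : Measure X} {F : Finset X} {C : AddSubgroup X} {π : X →+ C}
    {G : AddSubgroup C} (hF : ∀ x ∈ F, x ∈ C) (hπ : ∀ c : C, π c = c)
    (h : ∀ x₀ x : C, μ.real (π ⁻¹' {x₀}) ≠ 0 →
      (x - x₀ ∈ G → μ.real (π ⁻¹' {x}) = μ.real (π ⁻¹' {x₀})) ∧
        (x - x₀ ∉ G → μ.real (π ⁻¹' {x}) = 0)) :
    ∃ π' : X → X, (∀ x ∈ F, π' x = x) ∧ ∀ x y, μ.real (π' ⁻¹' {π' x}) ≠ 0 →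
      μ.real (π' ⁻¹' {π' y}) ≠ 0 → μ.real (π' ⁻¹' {π' x}) = μ.real (π' ⁻¹' {π' y}) := by
  have hpre : ∀ x, (fun x => (π x : X)) ⁻¹' {(π x : X)} = π ⁻¹' {π x} := fun x =>
    Set.ext fun _ => Subtype.ext_iff.symm
  refine ⟨fun x => π x, fun x hx => congrArg Subtype.val (hπ ⟨x, hF x hx⟩), fun x y hx hy => ?_⟩
  simp only [hpre] at hx hy ⊢
  by_cases hG : π x - π y ∈ G
  · exact (h _ _ hy).1 hG
  · exact absurd ((h _ _ hy).2 hG) hx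

end

lemma isShift_of_uniform_retract {X : Type*} [AddCommGroup X] [TopologicalSpace X]
    [DiscreteTopology X] [MeasurableSpace X] [BorelSpace X] [Countable X] {μ : Measure X}
    [IsProbabilityMeasure μ] {C : AddSubgroup X} {π : X →+ C} {G : AddSubgroup C}
    [Finite (G.map C.subtype)] (hπ : ∀ c : C, π c = c) (hC : ∀ x, μ.real {x} ≠ 0 → x ∈ C)
    (h : ∀ x₀ x : C, μ.real (π ⁻¹' {x₀}) ≠ 0 →
      (x - x₀ ∈ G → μ.real (π ⁻¹' {x}) = μ.real (π ⁻¹' {x₀})) ∧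
        (x - x₀ ∉ G → μ.real (π ⁻¹' {x}) = 0)) :
    IsShift μ (haarDistribution (G.map C.subtype)) := by
  have := discreteMeasurableSpace_of_borelSpace X
  obtain ⟨x₀, hx₀⟩ := exists_measureReal_singleton_ne_zero μ
  have hx₀C := hC x₀ hx₀
  simp only [measureReal_preimage_retract hπ hC] at h
  refine isShift_haarDistribution_of_uniform μ _ x₀ (fun x hx => ?_) fun x hx => ?_
  · obtain ⟨g, hg, hgx⟩ := hx
    have hxC : x ∈ C := by
      rw [← sub_add_cancel x x₀, ← hgx]; exact add_mem g.2 hx₀C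
    refine (h ⟨x₀, hx₀C⟩ ⟨x, hxC⟩ hx₀).1 ?_
    have : (⟨x, hxC⟩ : C) - ⟨x₀, hx₀C⟩ = g := Subtype.ext hgx.symm
    rwa [this]
  · by_contra h0
    exact h0 ((h ⟨x₀, hx₀C⟩ ⟨x, hC x h0⟩ hx₀).2 fun hG => hx ⟨_, hG, rfl⟩)

end Heyde

/-! ### The theorem -/

open Heyde

theorem corollary2p9
    {X : Type*} [AddCommGroup X] [TopologicalSpace X] [DiscreteTopology X]
    [MeasurableSpace X] [BorelSpace X]
    (htors : IsAddTorsion X)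
    (hcyc : ∀ p : ℕ, p.Prime → IsAddCyclic (AddCommGroup.primaryComponent X p))
    (htwo : ∀ x : X, addOrderOf x ≠ 2)
    (α : X ≃+ X)
    {Ω : Type*} [MeasurableSpace Ω] (P : Measure Ω) [IsProbabilityMeasure P]
    (ξ₁ ξ₂ : Ω → X) (hξ₁ : Measurable ξ₁) (hξ₂ : Measurable ξ₂)
    (hindep : IndepFun ξ₁ ξ₂ P)
    (μ₁ μ₂ : Measure X) (hμ₁ : P.map ξ₁ = μ₁) (hμ₂ : P.map ξ₂ = μ₂)
    (hsymm : Heyde.CondDistribSymmetric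
      (fun ω => ξ₁ ω + α (ξ₂ ω)) (fun ω => ξ₁ ω + ξ₂ ω) P) :
    (Heyde.kerOneAdd α = ⊥ →
      ∃ (G : AddSubgroup X) (_ : Finite G),
        Heyde.IsShift μ₁ (Heyde.haarDistribution G) ∧
        Heyde.IsShift μ₂ (Heyde.haarDistribution G)) ∧
    ((∀ y : AddChar X Circle, Heyde.charFn μ₁ y ≠ 0) →
      (∀ y : AddChar X Circle, Heyde.charFn μ₂ y ≠ 0) →
      ∃ ν : Measure X, IsProbabilityMeasure ν ∧ ν (Heyde.kerOneAdd α : Set X)ᶜ = 0 ∧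
        Heyde.IsShift μ₁ ν ∧ Heyde.IsShift μ₂ ν) := by
  classical
  subst hμ₁ hμ₂
  have := discreteMeasurableSpace_of_borelSpace X
  have := countable_of_isAddTorsion htors hcyc
  have := Measure.isProbabilityMeasure_map (μ := P) hξ₁.aemeasurable
  have := Measure.isProbabilityMeasure_map (μ := P) hξ₂.aemeasurable
  refine ⟨fun hker => ?_, fun hne₁ hne₂ => ?_⟩
  · have hret := exists_uniform_retract htors hcyc htwo hξ₁ hξ₂ hindep hsymm hker
    have hfin₁ := finite_setOf_measureReal_ne_zero (P.map ξ₁) fun x y =>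
      measureReal_singleton_eq_of_retract _ fun F => by
        obtain ⟨C, _, π, G, hF, hπ, h₁, -⟩ := hret F
        exact exists_retract_of_uniform hF hπ h₁
    have hfin₂ := finite_setOf_measureReal_ne_zero (P.map ξ₂) fun x y =>
      measureReal_singleton_eq_of_retract _ fun F => by
        obtain ⟨C, _, π, G, hF, hπ, -, h₂⟩ := hret F
        exact exists_retract_of_uniform hF hπ h₂
    -- A single summand containing both supports gives the same `G` for both distributions.
    obtain ⟨C, _, π, G, hF, hπ, h₁, h₂⟩ := hret (hfin₁.toFinset ∪ hfin₂.toFinset)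
    have hfin : Finite (G.map C.subtype) := inferInstanceAs (Finite (C.subtype '' (G : Set C)))
    exact ⟨G.map C.subtype, hfin,
      isShift_of_uniform_retract hπ (fun x hx => hF x (by simp [hx])) h₁,
      isShift_of_uniform_retract hπ (fun x hx => hF x (by simp [hx])) h₂⟩
  · have hk := sub_mem_kerOneAdd htors hcyc htwo hξ₁ hξ₂ hindep hsymm hne₁ hne₂
    exact exists_common_shift htwo hξ₁ hξ₂ hindep hsymm (fun x x' => (hk x x').1)
      (fun x x' => (hk x x').2)
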